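/- For integers $s,t,p,q,w,r$ and $\tau=\tau_1+i\tau_2$ with $\tau_2>0$, let $$C_{s,t,p,q,w,r}(\tau)=\sideset{}{'}\sum_{p_1,p_2,p_3\in\mathbb Z+\mathbb Z\tau}\frac{(\tau_2/\pi)^{s+t+p+q+w+r}}{|p_1|^{2s}\,|p_2|^{2t}\,|p_1+p_2|^{2p}\,|p_3|^{2q}\,|p_2+p_3|^{2w}\,|p_1+p_2+p_3|^{2r}},$$ where the prime means that only triples for which all six of $p_1$, $p_2$, $p_1+p_2$, $p_3$, $p_2+p_3$, $p_1+p_2+p_3$ are nonzero are summed over. View $s,t,p,q,w,r$ as labels of the edges of a tetrahedron with vertices $z_1,\dots,z_4$, where $\{s,t,p\}$, $\{t,q,w\}$, $\{s,w,r\}$, $\{p,q,r\}$ are the triples of edges meeting at $z_1,z_2,z_3,z_4$; two edges are adjacent if they share a vertex (12 pairs) and opposite otherwise (the 3 pairs $\{s,q\},\{t,r\},\{p,w\}$). Write $C=C_{s,t,p,q,w,r}$, and write, for instance, $C[a{+}1,b{-}1]$ for the function obtained from $C$ by adding $1$ to the exponent of edge $a$ and subtracting $1$ from that of edge $b$, the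 other exponents being unchanged. Let $\Delta=4\tau_2^2\partial_\tau\partial_{\bar\tau}=\tau_2^2(\partial_{\tau_1}^2+\partial_{\tau_2}^2)$ and $$\omega=\sum_{x\in\{s,t,p,q,w,r\}}x(x-1)-2(wp+qs+rt).$$ Let $s,t,p,q,w,r$ be positive integers. Then the series defining $C$ and all functions on the right-hand side below converge absolutely, $C$ is twice continuously differentiable on the upper half plane, and there $$(\Delta-\omega)\,C=\sum_{\{a,b\}\text{ adjacent}}ab\,A_{ab}+\sum_{\{a,b\}\text{ opposite}}ab\,O_{ab},$$ where, for adjacent edges $a,b$ with $c$ the third edge at their common vertex, $$A_{ab}=C[a{-}1,b{+}1]+C[a{+}1,b{-}1]+C[a{+}1,b{+}1,c{-}2]-2C[a{+}1,c{-}1]-2C[b{+}1,c{-}1],$$ and, for opposite edges $a,b$ with $\{c,c'\}$ and $\{d,d'\}$ the two other opposite pairs, $$O_{ab}=\sum_{x\in\{c,c',d,d'\}}C[a{+}1,b{+}1,x{-}2]+2C[a{+}1,b{+}1,c{-}1,c'{-}1]+2C[a{+}1,b{+}1,d{-}1,d'{-}1]-2\sum_{x\in\{c,c'\}}\sum_{y\in\{d,d'\}}C[a{+}1,b{+}1,x{-}1,y{-}1].$$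 -/

import Mathlib

noncomputable section

/-- The six edges of the tetrahedron with vertices `z₁, z₂, z₃, z₄`:
`s = z₁z₃`, `t = z₁z₂`, `p = z₁z₄`, `q = z₂z₄`, `w = z₂z₃`, `r = z₃z₄`.
An exponent vector `(s,t,p,q,w,r)` is a function `k : TetEdge → ℤ`. -/
inductive TetEdge
  | s | t | p | q | w | r
  deriving DecidableEq

namespace TetEdge

instance : Fintype TetEdge where
  elems := {s, t, p, q, w, r}
  complete e := by cases e <;> decide

/-- The (integer coordinates of the) momentum running through each edge, in terms of the three
loop momenta, after momentum conservation at the four vertices has been solved. -/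
def momentum (P : (ℤ × ℤ) × (ℤ × ℤ) × (ℤ × ℤ)) : TetEdge → ℤ × ℤ
  | s => P.1
  | t => P.2.1
  | p => P.1 + P.2.1
  | q => P.2.2
  | w => P.2.1 + P.2.2
  | r => P.1 + P.2.1 + P.2.2

/-- The exponent shift that adds `1` on the edge `e`. -/
def unit (e : TetEdge) : TetEdge → ℤ := Pi.single e 1

/-- The twelve adjacent pairs of edges `{a, b}`, three for each of the vertices
`z₁, z₂, z₃, z₄`, listed as `(a, b, c)` where `c` is the third edge at the common vertex. -/
def adjacentPairs : List (TetEdge × TetEdge × TetEdge) :=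
  [(s, t, p), (t, p, s), (p, s, t),
   (t, q, w), (q, w, t), (w, t, q),
   (s, w, r), (w, r, s), (r, s, w),
   (p, q, r), (q, r, p), (r, p, q)]

/-- The three opposite pairs of edges `{a, b}`, listed as `(a, b, c, c', d, d')` where
`{c, c'}` and `{d, d'}` are the two other opposite pairs. -/
def oppositePairs : List (TetEdge × TetEdge × TetEdge × TetEdge × TetEdge × TetEdge) :=
  [(s, q, t, r, p, w), (t, r, s, q, p, w), (p, w, s, q, t, r)]

/-- Coefficients and exponent shifts of the source terms of an adjacent pair `{a, b}` whose
common vertex has third edge `c`. -/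
def adjacentTerms : TetEdge × TetEdge × TetEdge → List (ℤ × (TetEdge → ℤ))
  | (a, b, c) =>
    [(1, -unit a + unit b),
     (1, unit a - unit b),
     (1, unit a + unit b - 2 • unit c),
     (-2, unit a - unit c),
     (-2, unit b - unit c)]

/-- Coefficients and exponent shifts of the source terms of an opposite pair `{a, b}`, where
`{c, c'}` and `{d, d'}` are the two other opposite pairs. -/
def oppositeTerms : TetEdge × TetEdge × TetEdge × TetEdge × TetEdge × TetEdge →
    List (ℤ × (TetEdge → ℤ))
  | (a, b, c, c', d, d') =>
    [(1, unit a + unit b - 2 • unit c),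
     (1, unit a + unit b - 2 • unit c'),
     (1, unit a + unit b - 2 • unit d),
     (1, unit a + unit b - 2 • unit d'),
     (2, unit a + unit b - unit c - unit c'),
     (2, unit a + unit b - unit d - unit d'),
     (-2, unit a + unit b - unit c - unit d),
     (-2, unit a + unit b - unit c - unit d'),
     (-2, unit a + unit b - unit c' - unit d),
     (-2, unit a + unit b - unit c' - unit d')]

end TetEdge

/-- The discrete torus momentum `m + n τ`. -/
def torusMomentum (τ : ℂ) (x : ℤ × ℤ) : ℂ := (x.1 : ℂ) + (x.2 : ℂ) * τ

/-- The summand of the tetrahedral lattice sum with exponents `k`: the product over the six edges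
of `(τ₂ / (π |p_e|²)) ^ k_e`, where loop momenta for which some edge momentum vanishes are
left out of the sum. -/
def tetSummand (k : TetEdge → ℤ) (τ : ℂ) (P : (ℤ × ℤ) × (ℤ × ℤ) × (ℤ × ℤ)) : ℝ :=
  if ∀ e, TetEdge.momentum P e ≠ 0 then
    ∏ e, (τ.im / (Real.pi * ‖torusMomentum τ (TetEdge.momentum P e)‖ ^ 2)) ^ (k e)
  else 0

/-- The tetrahedral modular graph function `C_{s,t,p,q,w,r}(τ)`, of interest for `0 < τ.im`. -/
def tetC (k : TetEdge → ℤ) (τ : ℂ) : ℝ := ∑' P, tetSummand k τ P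

/-- The modular Laplacian `τ₂² (∂²/∂τ₁² + ∂²/∂τ₂²)`; Mathlib's Laplacian is taken on `ℂ` as a real
Euclidean plane. -/
def modularLaplacian (f : ℂ → ℝ) (τ : ℂ) : ℝ := τ.im ^ 2 * Laplacian.laplacian f τ

/-- The `eigenvalue`
`ω = ∑_e k_e (k_e - 1) - 2 (w p + q s + r t)`. -/
def tetOmega (k : TetEdge → ℤ) : ℤ :=
  (∑ e, k e * (k e - 1)) - 2 * (k .w * k .p + k .q * k .s + k .r * k .t)

/-- `∑ c · C_{k + δ}(τ)` over a list of pairs `(c, δ)` of a coefficient and an exponent shift. -/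
def tetCombination (k : TetEdge → ℤ) (τ : ℂ) (L : List (ℤ × (TetEdge → ℤ))) : ℝ :=
  (L.map fun x => (x.1 : ℝ) * tetC (k + x.2) τ).sum

end

/-! The identity holds term by term before summation. For fixed loop momenta the summand is `F = ∏
u_e ^ k_e` with `u_e = τ₂ / (π |p_e|²)`, and `∂ log u_e = φ_e / (2 i τ₂)` with the unimodular phase
`φ_e = p̄_e / p_e`. Differentiating once more gives `Δ F = F (|∑ k_e φ_e|² - ∑ k_e)`. The square
expands into `∑ k_e²` plus `k_a k_b · 2 Re(φ_a φ̄_b)` over pairs of edges, and `2 Re(φ_a φ̄_b) = (2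
Re p_a p̄_b)² / (|p_a|² |p_b|²) - 2`.

Momentum conservation turns the inner product into squared lengths: up to sign, `2 Re p_a p̄_b` is
`|p_c|² - |p_a|² - |p_b|²` for adjacent edges and `|p_c|² + |p_c'|² - |p_d|² - |p_d'|²` for opposite
ones. Each ratio of squared lengths is an inverse ratio of modes, that is, a shift of exponents. In
the adjacent case the `-2` cancels against the expanded square; in the opposite case it remains and
forms the last part of `ω` (`sum_adjacentTerms`, `sum_oppositeTerms`, `tetSummand_identity`).

The analysis rests on `∑ u²` converging over the lattice. Edges `a`, `opp a` and any third edge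
carry independent momenta, so `u_a² u_{opp a}² u_x²` is summable; the inequality between arithmetic
and geometric means and the triangle inequality reduce every required series to such ones. Since
modes are bounded, only the case of all exponents one, with shifts, needs checking. On a disc around
`τ₀` the terms and their first two derivatives are dominated by multiples of the summand at `τ₀`,
which allows termwise differentiation (`hasSum_modularLaplacian_tetC`). -/

open Real

/-! ### Modes of the Green function: positivity, square summability, boundedness. -/

/-- The Fourier mode `τ₂ / (π |m + n τ|²)` of the Green function of the torus. -/
noncomputable def greenMode (τ : ℂ) (x : ℤ × ℤ) : ℝ := τ.im / (π * ‖torusMomentum τ x‖ ^ 2)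

lemma torusMomentum_add (τ : ℂ) (x y : ℤ × ℤ) :
    torusMomentum τ (x + y) = torusMomentum τ x + torusMomentum τ y := by
  simp only [torusMomentum, Prod.fst_add, Prod.snd_add, Int.cast_add]; ring

lemma abs_snd_mul_im_le (τ : ℂ) (x : ℤ × ℤ) : |(x.2 : ℝ)| * |τ.im| ≤ ‖torusMomentum τ x‖ := by
  have h : (torusMomentum τ x).im = x.2 * τ.im := by simp [torusMomentum]
  rw [← abs_mul, ← h]
  exact Complex.abs_im_le_norm _

lemma torusMomentum_ne_zero {τ : ℂ} (hτ : 0 < τ.im) {x : ℤ × ℤ} (hx : x ≠ 0) :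
    torusMomentum τ x ≠ 0 := by
  intro h
  have h2 := abs_snd_mul_im_le τ x
  rw [h, norm_zero, ← abs_mul] at h2
  have h3 : (x.2 : ℝ) = 0 := by
    rcases mul_eq_zero.1 (abs_nonpos_iff.1 h2) with h | h
    · exact h
    · exact absurd h hτ.ne'
  have h4 : x.2 = 0 := by exact_mod_cast h3
  simp only [torusMomentum, h4, Int.cast_zero, zero_mul, add_zero, Int.cast_eq_zero] at h
  exact hx (Prod.ext h h4)

lemma greenMode_nonneg {τ : ℂ} (hτ : 0 < τ.im) (x : ℤ × ℤ) : 0 ≤ greenMode τ x := by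
  unfold greenMode; positivity

lemma greenMode_pos {τ : ℂ} (hτ : 0 < τ.im) {x : ℤ × ℤ} (hx : x ≠ 0) : 0 < greenMode τ x := by
  have := norm_pos_iff.2 (torusMomentum_ne_zero hτ hx)
  unfold greenMode; positivity

lemma summable_greenMode_sq {τ : ℂ} (hτ : 0 < τ.im) :
    Summable fun x : ℤ × ℤ => greenMode τ x ^ 2 := by
  have h1 := EisensteinSeries.summable_one_div_norm_rpow (k := 4) (by norm_num)
  have h2 := (h1.mul_left (EisensteinSeries.r ⟨τ, hτ⟩ ^ (-4 : ℝ))).mul_left ((τ.im / π) ^ 2)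
  let e : ℤ × ℤ ≃ (Fin 2 → ℤ) := (Equiv.prodComm ℤ ℤ).trans (finTwoArrowEquiv ℤ).symm
  refine Summable.of_nonneg_of_le (fun x => by positivity) (fun x => ?_) (e.summable_iff.2 h2)
  have h3 := EisensteinSeries.summand_bound ⟨τ, hτ⟩ (k := 4) (by norm_num) (e x)
  have h4 : greenMode τ x ^ 2 = (τ.im / π) ^ 2 * ‖torusMomentum τ x‖ ^ (-4 : ℝ) := by
    rw [Real.rpow_neg (norm_nonneg _), show (4 : ℝ) = ((4 : ℕ) : ℝ) by norm_num,
      Real.rpow_natCast, greenMode]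
    rw [div_pow, mul_pow, div_pow, div_mul_eq_div_div, div_eq_mul_inv (_ / _), ← pow_mul]
  rw [h4]
  refine mul_le_mul_of_nonneg_left ?_ (by positivity)
  have h5 : torusMomentum τ x = (e x 0 : ℂ) * τ + (e x 1 : ℂ) := by
    simp [e, torusMomentum, add_comm]
  rw [h5]
  exact h3

/-- A mode that is at least 1 is at most its own square, hence at most the sum of all squares. -/
lemma exists_greenMode_le {τ : ℂ} (hτ : 0 < τ.im) :
    ∃ M : ℝ, 1 ≤ M ∧ ∀ x, greenMode τ x ≤ M := by
  refine ⟨max 1 (∑' x, greenMode τ x ^ 2), le_max_left _ _, fun x => ?_⟩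
  rcases le_total (greenMode τ x) 1 with h | h
  · exact h.trans (le_max_left _ _)
  · refine le_trans ?_ ((summable_greenMode_sq hτ).le_tsum x fun y _ => by positivity) |>.trans
      (le_max_right _ _)
    nlinarith

/-! ### Monomials in the six edge modes, and the summand as such a monomial. -/

namespace TetEdge

/-- The edge opposite to a given edge. -/
def opp : TetEdge → TetEdge
  | s => q
  | t => r
  | p => w
  | q => s
  | w => p
  | r => t

/-- The monomial `∏ e, u e ^ κ e`. -/
noncomputable def monomial (u : TetEdge → ℝ) (κ : TetEdge → ℤ) : ℝ := ∏ e, u e ^ κ e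

section Monomial

variable {u : TetEdge → ℝ} (hu : ∀ e, 0 < u e)
include hu

lemma monomial_pos (κ : TetEdge → ℤ) : 0 < monomial u κ :=
  Finset.prod_pos fun e _ => zpow_pos (hu e) _

lemma monomial_add (κ κ' : TetEdge → ℤ) :
    monomial u (κ + κ') = monomial u κ * monomial u κ' := by
  simp only [monomial, Pi.add_apply, ← Finset.prod_mul_distrib, zpow_add₀ (hu _).ne']

lemma monomial_sub (κ κ' : TetEdge → ℤ) :
    monomial u (κ - κ') = monomial u κ / monomial u κ' := by
  simp only [monomial, Pi.sub_apply, ← Finset.prod_div_distrib, zpow_sub₀ (hu _).ne']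

end Monomial

lemma monomial_neg (u : TetEdge → ℝ) (κ : TetEdge → ℤ) :
    monomial u (-κ) = (monomial u κ)⁻¹ := by
  simp only [monomial, Pi.neg_apply, ← Finset.prod_inv_distrib, zpow_neg]

lemma monomial_nsmul (u : TetEdge → ℝ) (n : ℕ) (κ : TetEdge → ℤ) :
    monomial u (n • κ) = monomial u κ ^ n := by
  simp only [monomial, Pi.smul_apply, ← Finset.prod_pow, nsmul_eq_mul, mul_comm (n : ℤ), zpow_mul,
    zpow_natCast]

lemma monomial_unit (u : TetEdge → ℝ) (e : TetEdge) : monomial u (unit e) = u e := by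
  rw [monomial, Finset.prod_eq_single e] <;> simp +contextual [unit]

lemma prod_univ {R : Type*} [CommMonoid R] (f : TetEdge → R) :
    ∏ e, f e = f s * f t * f p * f q * f w * f r := by
  rw [show (Finset.univ : Finset TetEdge) = {s, t, p, q, w, r} from rfl]
  simp [mul_assoc]

lemma sum_univ {R : Type*} [AddCommMonoid R] (f : TetEdge → R) :
    ∑ e, f e = f s + f t + f p + f q + f w + f r := by
  rw [show (Finset.univ : Finset TetEdge) = {s, t, p, q, w, r} from rfl]
  simp [add_assoc]

lemma monomial_one (u : TetEdge → ℝ) : monomial u 1 = u s * u t * u p * u q * u w * u r := by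
  simp [monomial, prod_univ]

/-- The modes of the six edges for given loop momenta. -/
noncomputable def modes (τ : ℂ) (P : (ℤ × ℤ) × (ℤ × ℤ) × (ℤ × ℤ)) (e : TetEdge) : ℝ :=
  greenMode τ (momentum P e)

lemma modes_pos {τ : ℂ} (hτ : 0 < τ.im) {P : (ℤ × ℤ) × (ℤ × ℤ) × (ℤ × ℤ)}
    (hP : ∀ e, momentum P e ≠ 0) (e : TetEdge) : 0 < modes τ P e :=
  greenMode_pos hτ (hP e)

lemma modes_nonneg {τ : ℂ} (hτ : 0 < τ.im) (P : (ℤ × ℤ) × (ℤ × ℤ) × (ℤ × ℤ)) (e : TetEdge) :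
    0 ≤ modes τ P e :=
  greenMode_nonneg hτ _

end TetEdge

open TetEdge

lemma tetSummand_of_ne {P : (ℤ × ℤ) × (ℤ × ℤ) × (ℤ × ℤ)} (hP : ∀ e, momentum P e ≠ 0)
    (κ : TetEdge → ℤ) (τ : ℂ) : tetSummand κ τ P = monomial (modes τ P) κ := if_pos hP

lemma tetSummand_of_eq {P : (ℤ × ℤ) × (ℤ × ℤ) × (ℤ × ℤ)} (hP : ¬ ∀ e, momentum P e ≠ 0)
    (κ : TetEdge → ℤ) (τ : ℂ) : tetSummand κ τ P = 0 := if_neg hP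

lemma tetSummand_nonneg {τ : ℂ} (hτ : 0 < τ.im) (κ : TetEdge → ℤ)
    (P : (ℤ × ℤ) × (ℤ × ℤ) × (ℤ × ℤ)) : 0 ≤ tetSummand κ τ P := by
  by_cases hP : ∀ e, momentum P e ≠ 0
  · rw [tetSummand_of_ne hP]
    exact (monomial_pos (modes_pos hτ hP) κ).le
  · rw [tetSummand_of_eq hP]

lemma summable_tetSummand_of_le {τ : ℂ} (hτ : 0 < τ.im) {κ : TetEdge → ℤ}
    {g : (ℤ × ℤ) × (ℤ × ℤ) × (ℤ × ℤ) → ℝ} (hg : Summable g) (hg0 : ∀ P, 0 ≤ g P)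
    (h : ∀ P, (∀ e, momentum P e ≠ 0) → monomial (modes τ P) κ ≤ g P) :
    Summable (tetSummand κ τ) := by
  refine Summable.of_nonneg_of_le (tetSummand_nonneg hτ κ) (fun P => ?_) hg
  by_cases hP : ∀ e, momentum P e ≠ 0
  · rw [tetSummand_of_ne hP]
    exact h P hP
  · rw [tetSummand_of_eq hP]
    exact hg0 P

/-- Bounded modes make each extra nonnegative power cost only a constant factor. This reduces
convergence for all positive exponents to exponents equal to one, shifted or not. -/
lemma summable_tetSummand_mono {τ : ℂ} (hτ : 0 < τ.im) {κ κ' : TetEdge → ℤ} (hκ : κ ≤ κ')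
    (h : Summable (tetSummand κ τ)) : Summable (tetSummand κ' τ) := by
  obtain ⟨M, hM1, hM⟩ := exists_greenMode_le hτ
  refine summable_tetSummand_of_le hτ (h.mul_left (monomial (fun _ => M) (κ' - κ)))
    (fun P => mul_nonneg (monomial_pos (fun _ => by positivity) _).le
      (tetSummand_nonneg hτ κ P)) fun P hP => ?_
  rw [tetSummand_of_ne hP, ← sub_add_cancel κ' κ, monomial_add (modes_pos hτ hP),
    sub_add_cancel]
  refine mul_le_mul_of_nonneg_right ?_ (monomial_pos (modes_pos hτ hP) κ).le
  refine Finset.prod_le_prod (fun e _ => (zpow_pos (modes_pos hτ hP e) _).le) fun e _ => ?_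
  exact zpow_le_zpow_left₀ (sub_nonneg.2 (hκ e)) (modes_nonneg hτ P e) (hM _)

/-! ### Absolute convergence of all the series. -/

/-- Removing `a` and `opp a` from the tetrahedron leaves a 4-cycle, and removing `x` as well leaves
a spanning tree, along which conservation determines the other momenta. -/
lemma momentum_triple_injective (a x : TetEdge) (hx : x ≠ a) (hx' : x ≠ opp a) :
    Function.Injective fun P : (ℤ × ℤ) × (ℤ × ℤ) × (ℤ × ℤ) =>
      (momentum P a, momentum P (opp a), momentum P x) := by
  rintro ⟨⟨a1, a2⟩, ⟨b1, b2⟩, ⟨c1, c2⟩⟩ ⟨⟨a1', a2'⟩, ⟨b1', b2'⟩, ⟨c1', c2'⟩⟩ h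
  simp only [Prod.mk.injEq] at h ⊢
  cases a <;> cases x <;>
    simp only [opp, ne_eq, not_true_eq_false] at hx hx' <;>
    simp only [momentum, opp, Prod.mk_add_mk, Prod.mk.injEq] at h <;>
    omega

lemma summable_modes_triple {τ : ℂ} (hτ : 0 < τ.im) (a x : TetEdge) (hx : x ≠ a)
    (hx' : x ≠ opp a) :
    Summable fun P => modes τ P a ^ 2 * (modes τ P (opp a) ^ 2 * modes τ P x ^ 2) := by
  have h1 := summable_greenMode_sq hτ
  have h0 : 0 ≤ fun x : ℤ × ℤ => greenMode τ x ^ 2 := fun x => sq_nonneg _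
  have h2 : Summable fun x : (ℤ × ℤ) × (ℤ × ℤ) => greenMode τ x.1 ^ 2 * greenMode τ x.2 ^ 2 :=
    h1.mul_of_nonneg h1 h0 h0
  have h3 : Summable fun x : (ℤ × ℤ) × (ℤ × ℤ) × (ℤ × ℤ) =>
      greenMode τ x.1 ^ 2 * (greenMode τ x.2.1 ^ 2 * greenMode τ x.2.2 ^ 2) :=
    h1.mul_of_nonneg h2 h0 fun x => mul_nonneg (h0 _) (h0 _)
  have h4 := h3.comp_injective (momentum_triple_injective a x hx hx')
  simpa only [Function.comp_def, modes] using h4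

namespace TetEdge

/-- The three edges `a`, `b`, `c` are those meeting at one of the vertices. -/
def Star (a b c : TetEdge) : Prop := (a, b, c) ∈ adjacentPairs ∨ (b, a, c) ∈ adjacentPairs

instance (a b c : TetEdge) : Decidable (Star a b c) := by unfold Star; infer_instance

lemma Star.swap {a b c : TetEdge} (h : Star a b c) : Star b a c := Or.symm h

lemma Star.rotate {a b c : TetEdge} (h : Star a b c) : Star b c a := by
  revert a b c; decide

lemma Star.nodup {a b c : TetEdge} (h : Star a b c) :
    [a, b, c, opp a, opp b, opp c].Nodup := by
  revert a b c; decide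

lemma prod_eq_of_nodup {R : Type*} [CommMonoid R] (f : TetEdge → R) {a b c d e g : TetEdge}
    (h : [a, b, c, d, e, g].Nodup) : ∏ x, f x = f a * f b * f c * f d * f e * f g := by
  have h1 : [a, b, c, d, e, g].toFinset = Finset.univ :=
    Finset.eq_univ_of_card _ (by rw [List.toFinset_card_of_nodup h]; rfl)
  rw [← h1, List.prod_toFinset f h]
  simp [mul_assoc]

lemma monomial_one_of_nodup (u : TetEdge → ℝ) {a b c d e g : TetEdge}
    (h : [a, b, c, d, e, g].Nodup) : monomial u 1 = u a * u b * u c * u d * u e * u g := by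
  simp [monomial, prod_eq_of_nodup _ h]

/-- Momentum conservation at a vertex, as a relation between the squared lengths of two momenta,
their inner product, and the squared length of the third momentum. -/
lemma Star.normSq_eq {a b c : TetEdge} (h : Star a b c) (τ : ℂ)
    (P : (ℤ × ℤ) × (ℤ × ℤ) × (ℤ × ℤ)) : ∃ ε : ℝ, ε ^ 2 = 1 ∧
      Complex.normSq (torusMomentum τ (momentum P c)) =
        Complex.normSq (torusMomentum τ (momentum P a)) +
        Complex.normSq (torusMomentum τ (momentum P b)) +
        2 * ε * (torusMomentum τ (momentum P a) *
          (starRingEnd ℂ) (torusMomentum τ (momentum P b))).re := by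
  have key : ∀ a b c, (a, b, c) ∈ adjacentPairs →
      torusMomentum τ (momentum P c) =
        torusMomentum τ (momentum P a) + torusMomentum τ (momentum P b) ∨
      torusMomentum τ (momentum P a) =
        torusMomentum τ (momentum P b) + torusMomentum τ (momentum P c) ∨
      torusMomentum τ (momentum P b) =
        torusMomentum τ (momentum P a) + torusMomentum τ (momentum P c) := by
    intro a b c habc
    simp only [adjacentPairs, List.mem_cons, Prod.mk.injEq, List.not_mem_nil, or_false] at habc
    rcases habc with ⟨rfl, rfl, rfl⟩ | ⟨rfl, rfl, rfl⟩ | ⟨rfl, rfl, rfl⟩ | ⟨rfl, rfl, rfl⟩ |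
      ⟨rfl, rfl, rfl⟩ | ⟨rfl, rfl, rfl⟩ | ⟨rfl, rfl, rfl⟩ | ⟨rfl, rfl, rfl⟩ | ⟨rfl, rfl, rfl⟩ |
      ⟨rfl, rfl, rfl⟩ | ⟨rfl, rfl, rfl⟩ | ⟨rfl, rfl, rfl⟩ <;>
    simp only [momentum, torusMomentum_add, true_or, or_true] <;> first
      | (left; ring1)
      | (right; left; ring1)
      | (right; right; ring1)
  -- The three momenta at a vertex satisfy a signed relation; solved for the one at `c`, only the
  -- relative and the overall sign remain, and the overall sign does not affect the squared length.
  have key' : torusMomentum τ (momentum P c) =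
        torusMomentum τ (momentum P a) + torusMomentum τ (momentum P b) ∨
      torusMomentum τ (momentum P c) =
        torusMomentum τ (momentum P a) - torusMomentum τ (momentum P b) ∨
      torusMomentum τ (momentum P c) =
        -(torusMomentum τ (momentum P a) - torusMomentum τ (momentum P b)) := by
    rcases h with h | h <;> rcases key _ _ _ h with h | h | h <;> rw [h] <;> ring_nf <;> simp
  rcases key' with h | h | h <;> rw [h]
  · exact ⟨1, by norm_num, by rw [Complex.normSq_add]; ring⟩
  · exact ⟨-1, by norm_num, by rw [Complex.normSq_sub]; ring⟩
  · exact ⟨-1, by norm_num, by rw [Complex.normSq_neg, Complex.normSq_sub]; ring⟩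

lemma modes_eq_div_normSq (τ : ℂ) (P : (ℤ × ℤ) × (ℤ × ℤ) × (ℤ × ℤ)) (e : TetEdge) :
    modes τ P e = τ.im / π / Complex.normSq (torusMomentum τ (momentum P e)) := by
  rw [modes, greenMode, Complex.normSq_eq_norm_sq, div_div]

/-- After clearing denominators this is `|p_c|² ≤ 2 (|p_a|² + |p_b|²)`, the triangle inequality at
the vertex. It serves to lower a double pole in `u c` to a simple one. -/
lemma Star.modes_mul_le {a b c : TetEdge} (h : Star a b c) {τ : ℂ} (hτ : 0 < τ.im)
    {P : (ℤ × ℤ) × (ℤ × ℤ) × (ℤ × ℤ)} (hP : ∀ e, momentum P e ≠ 0) :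
    modes τ P a * modes τ P b ≤ 2 * (modes τ P a + modes τ P b) * modes τ P c := by
  have hX : ∀ e, 0 < Complex.normSq (torusMomentum τ (momentum P e)) := fun e =>
    Complex.normSq_pos.2 (torusMomentum_ne_zero hτ (hP e))
  have hle : Complex.normSq (torusMomentum τ (momentum P c)) ≤
      2 * (Complex.normSq (torusMomentum τ (momentum P a)) +
        Complex.normSq (torusMomentum τ (momentum P b))) := by
    obtain ⟨ε, hε, h⟩ := h.normSq_eq τ P
    rw [h]
    simp only [Complex.normSq_apply, Complex.mul_re, Complex.conj_re, Complex.conj_im]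
    generalize (torusMomentum τ (momentum P a)) = x
    generalize (torusMomentum τ (momentum P b)) = y
    nlinarith [sq_nonneg (x.re - ε * y.re), sq_nonneg (x.im - ε * y.im)]
  have hXa := hX a
  have hXb := hX b
  have hXc := hX c
  have ht : 0 < τ.im / π := by positivity
  rw [modes_eq_div_normSq, modes_eq_div_normSq, modes_eq_div_normSq]
  generalize τ.im / π = t at ht
  generalize Complex.normSq (torusMomentum τ (momentum P a)) = X at *
  generalize Complex.normSq (torusMomentum τ (momentum P b)) = Y at *
  generalize Complex.normSq (torusMomentum τ (momentum P c)) = Z at *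
  rw [show t / X * (t / Y) = t ^ 2 * Z / (X * Y * Z) by field_simp,
    show 2 * (t / X + t / Y) * (t / Z) = t ^ 2 * (2 * (X + Y)) / (X * Y * Z) by field_simp; ring]
  gcongr

end TetEdge

/-- The monomial is `u_a² (u_{opp a} u_{opp c}) (u_b u_{opp b})`. The product of the two brackets is
at most the sum of their squares, which leaves the independent triples `a, opp a, opp c` and `b, opp
b, a`. -/
lemma summable_star_add_sub {a b c : TetEdge} (h : Star a b c) {τ : ℂ} (hτ : 0 < τ.im) :
    Summable (tetSummand (1 + (unit a - unit c)) τ) := by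
  have hne : (opp c ≠ a ∧ opp c ≠ opp a) ∧ a ≠ b ∧ a ≠ opp b := by revert a b c; decide
  have h1 := summable_modes_triple hτ a (opp c) hne.1.1 hne.1.2
  have h2 := summable_modes_triple hτ b a hne.2.1 hne.2.2
  refine summable_tetSummand_of_le hτ (h1.add h2) (fun P => by positivity) fun P hP => ?_
  have hu := modes_pos hτ hP
  rw [monomial_add hu, monomial_sub hu, monomial_unit, monomial_unit,
    monomial_one_of_nodup _ h.nodup]
  generalize modes τ P = u at hu
  have hc := hu c
  rw [show u a * u b * u c * u (opp a) * u (opp b) * u (opp c) * (u a / u c) =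
    u a ^ 2 * ((u (opp a) * u (opp c)) * (u b * u (opp b))) by field_simp]
  nlinarith [mul_nonneg (sq_nonneg (u a)) (sq_nonneg (u (opp a) * u (opp c) - u b * u (opp b))),
    mul_nonneg (sq_nonneg (u a)) (sq_nonneg (u (opp a) * u (opp c))),
    mul_nonneg (sq_nonneg (u a)) (sq_nonneg (u b * u (opp b)))]

/-- The triangle inequality gives `u_a u_b / u_c² ≤ 2 (u_a / u_c + u_b / u_c)`, two shifts already
known to converge. -/
lemma summable_star_add_add_sub {a b c : TetEdge} (h : Star a b c) {τ : ℂ} (hτ : 0 < τ.im) :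
    Summable (tetSummand (1 + (unit a + unit b - 2 • unit c)) τ) := by
  have h1 := summable_star_add_sub h hτ
  have h2 := summable_star_add_sub h.swap hτ
  refine summable_tetSummand_of_le hτ ((h1.add h2).mul_left 2)
    (fun P => mul_nonneg zero_le_two
      (add_nonneg (tetSummand_nonneg hτ _ P) (tetSummand_nonneg hτ _ P))) fun P hP => ?_
  have hu := modes_pos hτ hP
  have hF := monomial_pos hu 1
  have hle := h.modes_mul_le hτ hP
  simp only [tetSummand_of_ne hP, monomial_add hu, monomial_sub hu, monomial_nsmul,
    monomial_unit]
  have hc := hu c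
  generalize monomial (modes τ P) 1 = F at hF
  generalize modes τ P = u at *
  rw [← mul_add, ← mul_assoc, mul_comm 2, mul_assoc]
  refine mul_le_mul_of_nonneg_left ?_ hF.le
  rw [div_le_iff₀ (by positivity)]
  calc u a * u b ≤ 2 * (u a + u b) * u c := hle
    _ = _ := by field_simp

/-- The monomial is `(u_a u_{opp a})² u_v u_z`, and `u_v u_z ≤ u_v² + u_z²`. -/
lemma summable_opp_add_add_sub_sub {a x y v z : TetEdge} (h : [a, opp a, x, y, v, z].Nodup)
    {τ : ℂ} (hτ : 0 < τ.im) :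
    Summable (tetSummand (1 + (unit a + unit (opp a) - unit x - unit y)) τ) := by
  have h' := h
  simp only [List.nodup_cons, List.mem_cons, List.not_mem_nil, not_or] at h'
  have h1 := summable_modes_triple hτ a v (by tauto) (by tauto)
  have h2 := summable_modes_triple hτ a z (by tauto) (by tauto)
  refine summable_tetSummand_of_le hτ (h1.add h2) (fun P => by positivity) fun P hP => ?_
  have hu := modes_pos hτ hP
  simp only [monomial_add hu, monomial_sub hu, monomial_unit, monomial_one_of_nodup _ h]
  generalize modes τ P = u at hu
  have hx := hu x
  have hy := hu y
  rw [show u a * u (opp a) * u x * u y * u v * u z * (u a * u (opp a) / u x / u y) =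
    (u a * u (opp a)) ^ 2 * (u v * u z) by field_simp]
  nlinarith [mul_nonneg (sq_nonneg (u a * u (opp a))) (sq_nonneg (u v - u z)),
    mul_nonneg (sq_nonneg (u a * u (opp a))) (sq_nonneg (u v)),
    mul_nonneg (sq_nonneg (u a * u (opp a))) (sq_nonneg (u z))]

/-- Inserting `u_y / u_y` and using the triangle inequality at the vertex of `a, y, x` bounds `u_a
u_{opp a} / u_x²` by `2 (u_a u_{opp a} / (u_x u_y) + u_{opp a} / u_x)`. -/
lemma summable_opp_add_add_sub_two {a x y v z : TetEdge} (h : [a, opp a, x, y, v, z].Nodup)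
    (hs : Star a y x) {τ : ℂ} (hτ : 0 < τ.im) :
    Summable (tetSummand (1 + (unit a + unit (opp a) - 2 • unit x)) τ) := by
  -- The edge `x` joins the vertex of `a, y` to the vertex of their opposites.
  have hs' : Star (opp a) (opp y) x := by clear h; revert a y x; decide
  have h1 := summable_opp_add_add_sub_sub h hτ
  have h2 := summable_star_add_sub hs' hτ
  refine summable_tetSummand_of_le hτ ((h1.add h2).mul_left 2)
    (fun P => mul_nonneg zero_le_two
      (add_nonneg (tetSummand_nonneg hτ _ P) (tetSummand_nonneg hτ _ P))) fun P hP => ?_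
  have hu := modes_pos hτ hP
  have hF := monomial_pos hu 1
  have hle := hs.modes_mul_le hτ hP
  simp only [tetSummand_of_ne hP, monomial_add hu, monomial_sub hu, monomial_nsmul,
    monomial_unit]
  have hx := hu x
  have hy := hu y
  have ha := hu (opp a)
  generalize monomial (modes τ P) 1 = F at hF
  generalize modes τ P = u at *
  rw [← mul_add, ← mul_assoc, mul_comm 2, mul_assoc]
  refine mul_le_mul_of_nonneg_left ?_ hF.le
  rw [div_le_iff₀ (by positivity)]
  calc u a * u (opp a) = (u (opp a) / u y) * (u a * u y) := by field_simp
    _ ≤ (u (opp a) / u y) * (2 * (u a + u y) * u x) := by gcongr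
    _ = _ := by field_simp

/-- The six edges split into the two independent triples `s, q, t` and `p, w, r`. -/
lemma summable_tetSummand_one {τ : ℂ} (hτ : 0 < τ.im) : Summable (tetSummand 1 τ) := by
  have h1 := summable_modes_triple hτ s t (by decide) (by decide)
  have h2 := summable_modes_triple hτ p r (by decide) (by decide)
  refine summable_tetSummand_of_le hτ (h1.add h2) (fun P => by positivity) fun P hP => ?_
  rw [monomial_one]
  simp only [opp]
  generalize modes τ P = u
  nlinarith [sq_nonneg (u s * u q * u t - u p * u w * u r), sq_nonneg (u s * u q * u t),
    sq_nonneg (u p * u w * u r)]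

lemma summable_adjacentTerms {A : TetEdge × TetEdge × TetEdge} (hA : A ∈ adjacentPairs)
    {x : ℤ × (TetEdge → ℤ)} (hx : x ∈ adjacentTerms A) {τ : ℂ} (hτ : 0 < τ.im) :
    Summable (tetSummand (1 + x.2) τ) := by
  obtain ⟨a, b, c⟩ := A
  have h : Star a b c := Or.inl hA
  simp only [adjacentTerms, List.mem_cons, List.not_mem_nil, or_false] at hx
  rcases hx with rfl | rfl | rfl | rfl | rfl
  · rw [neg_add_eq_sub]
    exact summable_star_add_sub h.rotate hτ
  · exact summable_star_add_sub h.rotate.rotate.swap hτ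
  · exact summable_star_add_add_sub h hτ
  · exact summable_star_add_sub h hτ
  · exact summable_star_add_sub h.swap hτ

lemma summable_oppositeTerms {B : TetEdge × TetEdge × TetEdge × TetEdge × TetEdge × TetEdge}
    (hB : B ∈ oppositePairs) {x : ℤ × (TetEdge → ℤ)} (hx : x ∈ oppositeTerms B) {τ : ℂ}
    (hτ : 0 < τ.im) : Summable (tetSummand (1 + x.2) τ) := by
  obtain ⟨a, b, c, c', d, d'⟩ := B
  -- Each end of `a` meets one edge of `{c, c'}` and one of `{d, d'}`; which ones go together
  -- depends on the order of listing.
  have h : b = opp a ∧ [a, opp a, c, c', d, d'].Nodup ∧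
      (Star a d c ∧ Star a d' c' ∨ Star a d c' ∧ Star a d' c) := by
    simp only [oppositePairs, List.mem_cons, Prod.mk.injEq, List.not_mem_nil, or_false] at hB
    rcases hB with ⟨rfl, rfl, rfl, rfl, rfl, rfl⟩ | ⟨rfl, rfl, rfl, rfl, rfl, rfl⟩ |
      ⟨rfl, rfl, rfl, rfl, rfl, rfl⟩ <;> decide
  obtain ⟨rfl, hn, hs⟩ := h
  have perm : ∀ {x y v z}, [x, y, v, z].Perm [c, c', d, d'] →
      [a, opp a, x, y, v, z].Nodup := fun hp => (((hp.cons _).cons _).nodup_iff).2 hn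
  have hcd : [a, opp a, c, d, c', d'].Nodup := perm (by clear * -; grind)
  have hcd' : [a, opp a, c, d', c', d].Nodup := perm (by clear * -; grind)
  have hc'd : [a, opp a, c', d, c, d'].Nodup := perm (by clear * -; grind)
  have hc'd' : [a, opp a, c', d', c, d].Nodup := perm (by clear * -; grind)
  have hdc : [a, opp a, d, c, c', d'].Nodup := perm (by clear * -; grind)
  have hd'c : [a, opp a, d', c, c', d].Nodup := perm (by clear * -; grind)
  have hdc' : [a, opp a, d, c', c, d'].Nodup := perm (by clear * -; grind)
  have hd'c' : [a, opp a, d', c', c, d].Nodup := by clear * - hd'c; grind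
  have hdd' : [a, opp a, d, d', c, c'].Nodup := perm (by clear * -; grind)
  have rot : ∀ {x y}, Star a x y → Star a y x := fun h => h.rotate.rotate.swap
  simp only [oppositeTerms, List.mem_cons, List.not_mem_nil, or_false] at hx
  rcases hx with rfl | rfl | rfl | rfl | rfl | rfl | rfl | rfl | rfl | rfl
  · rcases hs with ⟨h1, h2⟩ | ⟨h1, h2⟩
    · exact summable_opp_add_add_sub_two hcd h1 hτ
    · exact summable_opp_add_add_sub_two hcd' h2 hτ
  · rcases hs with ⟨h1, h2⟩ | ⟨h1, h2⟩
    · exact summable_opp_add_add_sub_two hc'd' h2 hτ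
    · exact summable_opp_add_add_sub_two hc'd h1 hτ
  · rcases hs with ⟨h1, h2⟩ | ⟨h1, h2⟩
    · exact summable_opp_add_add_sub_two hdc (rot h1) hτ
    · exact summable_opp_add_add_sub_two hdc' (rot h1) hτ
  · rcases hs with ⟨h1, h2⟩ | ⟨h1, h2⟩
    · exact summable_opp_add_add_sub_two hd'c' (rot h2) hτ
    · exact summable_opp_add_add_sub_two hd'c (rot h2) hτ
  · exact summable_opp_add_add_sub_sub hn hτ
  · exact summable_opp_add_add_sub_sub hdd' hτ
  · exact summable_opp_add_add_sub_sub hcd hτ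
  · exact summable_opp_add_add_sub_sub hcd' hτ
  · exact summable_opp_add_add_sub_sub hc'd hτ
  · exact summable_opp_add_add_sub_sub hc'd' hτ

/-! ### Wirtinger calculus and the derivatives of a single summand. -/

open scoped ComplexConjugate

/-- The real-linear map `h ↦ α h + β h̄`, with `α = ∂f` and `β = ∂̄f` for the derivative of `f`. -/
noncomputable def wirtinger (α β : ℂ) : ℂ →L[ℝ] ℂ :=
  α • ContinuousLinearMap.id ℝ ℂ + β • Complex.conjCLE.toContinuousLinearMap

@[simp] lemma wirtinger_apply (α β h : ℂ) : wirtinger α β h = α * h + β * conj h := by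
  simp [wirtinger]

lemma norm_wirtinger_le (α β : ℂ) : ‖wirtinger α β‖ ≤ ‖α‖ + ‖β‖ := by
  refine ContinuousLinearMap.opNorm_le_bound _ (by positivity) fun h => ?_
  rw [wirtinger_apply, add_mul]
  refine (norm_add_le _ _).trans ?_
  simp

lemma continuous_wirtinger : Continuous fun x : ℂ × ℂ => wirtinger x.1 x.2 := by
  unfold wirtinger
  fun_prop

section Rules

variable {f g : ℂ → ℂ} {α β α' β' τ : ℂ}

lemma hasWirtinger_of {D : ℂ →L[ℝ] ℂ} (hf : HasFDerivAt f D τ)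
    (h : ∀ z, D z = α * z + β * conj z) : HasFDerivAt f (wirtinger α β) τ :=
  hf.congr_fderiv (ContinuousLinearMap.ext fun z => by rw [h, wirtinger_apply])

lemma hasWirtinger_congr (hf : HasFDerivAt f (wirtinger α β) τ) (hα : α = α') (hβ : β = β') :
    HasFDerivAt f (wirtinger α' β') τ := hα ▸ hβ ▸ hf

lemma hasWirtinger_mul (hf : HasFDerivAt f (wirtinger α β) τ)
    (hg : HasFDerivAt g (wirtinger α' β') τ) :
    HasFDerivAt (fun x => f x * g x)
      (wirtinger (f τ * α' + g τ * α) (f τ * β' + g τ * β)) τ := by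
  refine hasWirtinger_of (hf.fun_mul hg) fun z => ?_
  simp only [add_apply, smul_apply, wirtinger_apply,
    smul_eq_mul]
  ring

lemma hasWirtinger_const (c : ℂ) : HasFDerivAt (fun _ => c) (wirtinger 0 0) τ := by
  refine hasWirtinger_of (hasFDerivAt_const c τ) fun z => ?_
  simp

lemma hasWirtinger_comp {φ : ℂ → ℂ} {φ' : ℂ} (hφ : HasDerivAt φ φ' (f τ))
    (hf : HasFDerivAt f (wirtinger α β) τ) :
    HasFDerivAt (fun x => φ (f x)) (wirtinger (φ' * α) (φ' * β)) τ := by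
  refine hasWirtinger_of ((hφ.hasFDerivAt.restrictScalars ℝ).comp τ hf) fun z => ?_
  simp only [ContinuousLinearMap.comp_apply, ContinuousLinearMap.coe_restrictScalars',
    ContinuousLinearMap.toSpanSingleton_apply, wirtinger_apply, smul_eq_mul]
  ring

lemma hasWirtinger_sum {ι : Type*} (S : Finset ι) {F : ι → ℂ → ℂ} {A B : ι → ℂ}
    (h : ∀ i ∈ S, HasFDerivAt (F i) (wirtinger (A i) (B i)) τ) :
    HasFDerivAt (fun x => ∑ i ∈ S, F i x) (wirtinger (∑ i ∈ S, A i) (∑ i ∈ S, B i)) τ := by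
  refine hasWirtinger_of (HasFDerivAt.fun_sum h) fun z => ?_
  simp [Finset.sum_add_distrib, Finset.sum_mul]

/-- Logarithmic derivatives of factors add up; writing the derivatives as `F i τ * A i` avoids
dividing by `F i τ`. -/
lemma hasWirtinger_prod {ι : Type*} (S : Finset ι) {F : ι → ℂ → ℂ} {A B : ι → ℂ}
    (h : ∀ i ∈ S, HasFDerivAt (F i) (wirtinger (F i τ * A i) (F i τ * B i)) τ) :
    HasFDerivAt (fun x => ∏ i ∈ S, F i x)
      (wirtinger ((∏ i ∈ S, F i τ) * ∑ i ∈ S, A i) ((∏ i ∈ S, F i τ) * ∑ i ∈ S, B i)) τ := by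
  classical
  induction S using Finset.induction_on with
  | empty => simpa using hasWirtinger_const 1
  | insert i S hi ih =>
    simp only [Finset.prod_insert hi, Finset.sum_insert hi]
    refine hasWirtinger_congr (hasWirtinger_mul (h i (Finset.mem_insert_self i S))
      (ih fun j hj => h j (Finset.mem_insert_of_mem hj))) ?_ ?_ <;> ring

end Rules

lemma hasWirtinger_torusMomentum (x : ℤ × ℤ) (τ : ℂ) :
    HasFDerivAt (fun τ => torusMomentum τ x) (wirtinger x.2 0) τ := by
  refine hasWirtinger_of (((hasFDerivAt_id τ).const_mul (x.2 : ℂ)).const_add (x.1 : ℂ))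
    fun z => ?_
  simp

lemma hasWirtinger_conj_torusMomentum (x : ℤ × ℤ) (τ : ℂ) :
    HasFDerivAt (fun τ => conj (torusMomentum τ x)) (wirtinger 0 x.2) τ := by
  refine hasWirtinger_of (Complex.conjCLE.toContinuousLinearMap.hasFDerivAt.comp τ
    (hasWirtinger_torusMomentum x τ)) fun z => ?_
  simp

lemma hasWirtinger_im (τ : ℂ) :
    HasFDerivAt (fun τ : ℂ => (τ.im : ℂ)) (wirtinger (1 / (2 * Complex.I)) (-1 / (2 * Complex.I)))
      τ := by
  refine hasWirtinger_of (Complex.ofRealCLM.comp Complex.imCLM).hasFDerivAt fun z => ?_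
  simp only [ContinuousLinearMap.comp_apply, Complex.imCLM_apply,
    Complex.ofRealCLM_apply, Complex.im_eq_sub_conj]
  ring

/-- The unimodular number `p̄ / p` for the momentum `p = m + n τ`. -/
noncomputable def phase (τ : ℂ) (x : ℤ × ℤ) : ℂ := conj (torusMomentum τ x) / torusMomentum τ x

lemma norm_phase_le (τ : ℂ) (x : ℤ × ℤ) : ‖phase τ x‖ ≤ 1 := by
  rw [phase, norm_div, RCLike.norm_conj]
  exact div_self_le_one _

/-- This eliminates the integer `n` produced by differentiating `m + n τ`, so that all derivatives
become polynomials in phases, bounded uniformly in the momentum. -/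
lemma snd_mul_im (τ : ℂ) (x : ℤ × ℤ) :
    (x.2 : ℂ) * τ.im = (torusMomentum τ x - conj (torusMomentum τ x)) / (2 * Complex.I) := by
  rw [← Complex.im_eq_sub_conj]
  simp [torusMomentum]

lemma hasWirtinger_phase {τ : ℂ} (hτ : 0 < τ.im) {x : ℤ × ℤ} (hx : x ≠ 0) :
    HasFDerivAt (fun τ => phase τ x)
      (wirtinger (-(1 - phase τ x) * phase τ x / (2 * Complex.I * τ.im))
        ((1 - phase τ x) / (2 * Complex.I * τ.im))) τ := by
  have hp := torusMomentum_ne_zero hτ hx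
  have ht : (τ.im : ℂ) ≠ 0 := by exact_mod_cast hτ.ne'
  have h2 := snd_mul_im τ x
  have hn : (x.2 : ℂ) = (torusMomentum τ x - conj (torusMomentum τ x)) /
      (2 * Complex.I * τ.im) := by
    rw [← div_div, ← h2, mul_div_cancel_right₀ _ ht]
  have h3 := hasWirtinger_mul (hasWirtinger_conj_torusMomentum x τ)
    (hasWirtinger_comp (hasDerivAt_inv hp) (hasWirtinger_torusMomentum x τ))
  simp only [phase, div_eq_mul_inv]
  refine hasWirtinger_congr h3 ?_ ?_ <;> rw [hn] <;> field_simp <;> ring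

lemma ofReal_greenMode (τ : ℂ) (x : ℤ × ℤ) : (greenMode τ x : ℂ) =
    τ.im * (π : ℂ)⁻¹ * ((torusMomentum τ x)⁻¹ * (conj (torusMomentum τ x))⁻¹) := by
  rw [greenMode, Complex.ofReal_div, Complex.ofReal_mul, ← Complex.normSq_eq_norm_sq,
    Complex.normSq_eq_conj_mul_self, div_eq_mul_inv, mul_inv, mul_inv]
  ring

lemma hasWirtinger_greenMode {τ : ℂ} (hτ : 0 < τ.im) {x : ℤ × ℤ} (hx : x ≠ 0) :
    HasFDerivAt (fun τ => (greenMode τ x : ℂ))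
      (wirtinger (greenMode τ x * (phase τ x / (2 * Complex.I * τ.im)))
        (greenMode τ x * (-conj (phase τ x) / (2 * Complex.I * τ.im)))) τ := by
  have hp := torusMomentum_ne_zero hτ hx
  have hp' : conj (torusMomentum τ x) ≠ 0 := (map_ne_zero _).2 hp
  have ht : (τ.im : ℂ) ≠ 0 := by exact_mod_cast hτ.ne'
  have hπ : (π : ℂ) ≠ 0 := by exact_mod_cast pi_ne_zero
  have h2 := snd_mul_im τ x
  have hn : (x.2 : ℂ) = (torusMomentum τ x - conj (torusMomentum τ x)) /
      (2 * Complex.I * τ.im) := by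
    rw [← div_div, ← h2, mul_div_cancel_right₀ _ ht]
  have h3 := hasWirtinger_mul (hasWirtinger_mul (hasWirtinger_im τ) (hasWirtinger_const (π : ℂ)⁻¹))
    (hasWirtinger_mul (hasWirtinger_comp (hasDerivAt_inv hp) (hasWirtinger_torusMomentum x τ))
      (hasWirtinger_comp (hasDerivAt_inv hp') (hasWirtinger_conj_torusMomentum x τ)))
  simp only [ofReal_greenMode, phase, map_div₀, Complex.conj_conj]
  refine hasWirtinger_congr h3 ?_ ?_ <;> rw [hn] <;> field_simp <;> ring

/-- `∑ e, k e (p̄_e / p_e) ^ n`. -/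
noncomputable def phaseSum (k : TetEdge → ℤ) (n : ℕ) (τ : ℂ) (P : (ℤ × ℤ) × (ℤ × ℤ) × (ℤ × ℤ)) :
    ℂ := ∑ e, (k e : ℂ) * phase τ (momentum P e) ^ n

lemma norm_phaseSum_le {k : TetEdge → ℤ} (hk : ∀ e, 0 ≤ k e) (n : ℕ) (τ : ℂ)
    (P : (ℤ × ℤ) × (ℤ × ℤ) × (ℤ × ℤ)) : ‖phaseSum k n τ P‖ ≤ ∑ e, (k e : ℝ) := by
  refine norm_sum_le_of_le _ fun e _ => ?_
  have h0 : (0 : ℝ) ≤ k e := by exact_mod_cast hk e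
  rw [norm_mul, norm_pow, Complex.norm_intCast, abs_of_nonneg h0]
  exact mul_le_of_le_one_right h0 (pow_le_one₀ (norm_nonneg _) (norm_phase_le _ _))

/-- The gradient `2 ∂̄` of a summand, conjugated, as a complex number. -/
noncomputable def tetGrad (k : TetEdge → ℤ) (τ : ℂ) (P : (ℤ × ℤ) × (ℤ × ℤ) × (ℤ × ℤ)) : ℂ :=
  tetSummand k τ P * (phaseSum k 1 τ P * (Complex.I * τ.im)⁻¹)

/-- The derivative of `tetGrad`. -/
noncomputable def tetHess (k : TetEdge → ℤ) (τ : ℂ) (P : (ℤ × ℤ) × (ℤ × ℤ) × (ℤ × ℤ)) :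
    ℂ →L[ℝ] ℂ :=
  wirtinger
    (tetSummand k τ P * (-phaseSum k 1 τ P ^ 2 / 2 + phaseSum k 1 τ P - phaseSum k 2 τ P / 2) /
      τ.im ^ 2)
    (tetSummand k τ P * (phaseSum k 1 τ P * conj (phaseSum k 1 τ P) - ∑ e, (k e : ℂ)) /
      (2 * τ.im ^ 2))

lemma hasWirtinger_tetSummand (k : TetEdge → ℤ) {τ : ℂ} (hτ : 0 < τ.im)
    (P : (ℤ × ℤ) × (ℤ × ℤ) × (ℤ × ℤ)) :
    HasFDerivAt (fun τ => (tetSummand k τ P : ℂ))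
      (wirtinger (tetSummand k τ P * (phaseSum k 1 τ P / (2 * Complex.I * τ.im)))
        (tetSummand k τ P * (-conj (phaseSum k 1 τ P) / (2 * Complex.I * τ.im)))) τ := by
  by_cases hP : ∀ e, momentum P e ≠ 0
  · simp only [tetSummand_of_ne hP, monomial, Complex.ofReal_prod, Complex.ofReal_zpow, phaseSum,
      pow_one, map_sum, map_mul, map_intCast, Finset.sum_div, ← Finset.sum_neg_distrib]
    refine hasWirtinger_prod Finset.univ fun e _ => ?_
    have hu : (modes τ P e : ℂ) ≠ 0 := by exact_mod_cast (modes_pos hτ hP e).ne'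
    refine hasWirtinger_congr (hasWirtinger_comp
      (hasDerivAt_zpow (k e) (modes τ P e : ℂ) (Or.inl hu))
      (hasWirtinger_greenMode hτ (hP e))) ?_ ?_ <;>
    · rw [zpow_sub_one₀ hu]
      simp only [modes] at *
      field_simp
  · simp only [tetSummand_of_eq hP, Complex.ofReal_zero, zero_mul]
    exact hasWirtinger_const 0

/-- The pairing `g, h ↦ Re (g h)`. -/
noncomputable def rePairing : ℂ →L[ℝ] ℂ →L[ℝ] ℝ :=
  (ContinuousLinearMap.compL ℝ ℂ ℂ ℝ Complex.reCLM) ∘L (ContinuousLinearMap.mul ℝ ℂ)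

@[simp] lemma rePairing_apply (g h : ℂ) : rePairing g h = (g * h).re := rfl

lemma hasFDerivAt_tetSummand (k : TetEdge → ℤ) {τ : ℂ} (hτ : 0 < τ.im)
    (P : (ℤ × ℤ) × (ℤ × ℤ) × (ℤ × ℤ)) :
    HasFDerivAt (fun τ => tetSummand k τ P) (rePairing (tetGrad k τ P)) τ := by
  have h := Complex.reCLM.hasFDerivAt.comp τ (hasWirtinger_tetSummand k hτ P)
  have hconj : -conj (phaseSum k 1 τ P) / (2 * Complex.I * τ.im) =
      conj (phaseSum k 1 τ P / (2 * Complex.I * τ.im)) := by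
    simp only [map_div₀, map_mul, Complex.conj_I, Complex.conj_ofReal, map_ofNat]
    rw [mul_neg, neg_mul, div_neg, neg_div]
  have hhalf : phaseSum k 1 τ P * (Complex.I * τ.im)⁻¹ =
      2 * (phaseSum k 1 τ P / (2 * Complex.I * τ.im)) := by
    rw [mul_assoc 2, ← div_div, ← mul_div_assoc, mul_div_cancel₀ _ two_ne_zero, div_eq_mul_inv]
  refine h.congr_fderiv (ContinuousLinearMap.ext fun z => ?_)
  rw [hconj]
  simp only [ContinuousLinearMap.comp_apply, Complex.reCLM_apply, wirtinger_apply, tetGrad, hhalf,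
    rePairing_apply]
  generalize phaseSum k 1 τ P / (2 * Complex.I * τ.im) = q
  simp only [Complex.add_re, Complex.mul_re, Complex.mul_im, Complex.conj_re, Complex.conj_im,
    Complex.ofReal_re, Complex.ofReal_im, Complex.re_ofNat, Complex.im_ofNat]
  ring

lemma hasFDerivAt_tetGrad (k : TetEdge → ℤ) {τ : ℂ} (hτ : 0 < τ.im)
    (P : (ℤ × ℤ) × (ℤ × ℤ) × (ℤ × ℤ)) :
    HasFDerivAt (fun τ => tetGrad k τ P) (tetHess k τ P) τ := by
  by_cases hP : ∀ e, momentum P e ≠ 0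
  · have ht : (τ.im : ℂ) ≠ 0 := by exact_mod_cast hτ.ne'
    -- Since `∂ φ = (φ² - φ) / (2 i τ₂)` and `∂̄ φ = (1 - φ) / (2 i τ₂)`, the sum of squared phases
    -- enters the holomorphic part only.
    have h1 : HasFDerivAt (fun τ => phaseSum k 1 τ P)
        (wirtinger ((phaseSum k 2 τ P - phaseSum k 1 τ P) / (2 * Complex.I * τ.im))
          ((∑ e, (k e : ℂ) - phaseSum k 1 τ P) / (2 * Complex.I * τ.im))) τ := by
      have := hasWirtinger_sum (τ := τ) Finset.univ fun e _ =>
        hasWirtinger_mul (hasWirtinger_const (k e : ℂ)) (hasWirtinger_phase hτ (hP e))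
      simp only [phaseSum, pow_one]
      refine hasWirtinger_congr this ?_ ?_ <;> rw [← Finset.sum_sub_distrib, Finset.sum_div] <;>
        refine Finset.sum_congr rfl fun e _ => ?_ <;> ring
    have h2 := hasWirtinger_comp (f := fun τ : ℂ => Complex.I * (τ.im : ℂ))
      (hasDerivAt_inv (mul_ne_zero Complex.I_ne_zero ht))
      (hasWirtinger_mul (hasWirtinger_const Complex.I) (hasWirtinger_im τ))
    have h3 := hasWirtinger_mul (hasWirtinger_tetSummand k hτ P) (hasWirtinger_mul h1 h2)
    refine hasWirtinger_congr h3 ?_ ?_ <;> field_simp <;> rw [Complex.I_sq] <;> ring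
  · simp only [tetGrad, tetHess, tetSummand_of_eq hP, Complex.ofReal_zero, zero_mul, zero_div]
    exact hasWirtinger_const 0

/-! ### Domination on a disc of radius `τ₀.im / 2`, and continuity of the second derivative. -/

section Comparison

variable {τ₀ τ : ℂ} (hτ₀ : 0 < τ₀.im) (hτ : τ ∈ Metric.ball τ₀ (τ₀.im / 2))
include hτ

lemma abs_im_sub_lt_of_mem_ball : |τ.im - τ₀.im| < τ₀.im / 2 := by
  rw [mem_ball_iff_norm] at hτ
  rw [← Complex.sub_im]
  exact (Complex.abs_im_le_norm _).trans_lt hτ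

lemma half_im_lt_of_mem_ball : τ₀.im / 2 < τ.im := by
  have := (abs_lt.1 (abs_im_sub_lt_of_mem_ball hτ)).1
  linarith

include hτ₀

lemma im_pos_of_mem_ball : 0 < τ.im := (half_pos hτ₀).trans (half_im_lt_of_mem_ball hτ)

/-- Moving `τ` changes the momentum by at most `|n| τ₀.im / 2`, at most half its length at `τ₀`. The
length thus at least halves and `τ.im` grows at most by `3 / 2`, whence `6 = 4 · 3 / 2`. -/
lemma greenMode_le_of_mem_ball {x : ℤ × ℤ} (hx : x ≠ 0) :
    greenMode τ x ≤ 6 * greenMode τ₀ x := by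
  have h1 := abs_snd_mul_im_le τ₀ x
  rw [abs_of_pos hτ₀] at h1
  have h2 : torusMomentum τ₀ x - torusMomentum τ x = x.2 * (τ₀ - τ) := by
    simp only [torusMomentum]; ring
  have h3 : ‖torusMomentum τ₀ x‖ - ‖torusMomentum τ x‖ ≤ |(x.2 : ℝ)| * (τ₀.im / 2) := by
    refine (norm_sub_norm_le _ _).trans ?_
    rw [h2, norm_mul, Complex.norm_intCast]
    refine mul_le_mul_of_nonneg_left ?_ (abs_nonneg _)
    rw [mem_ball_iff_norm'] at hτ
    exact hτ.le
  have h4 : ‖torusMomentum τ₀ x‖ / 2 ≤ ‖torusMomentum τ x‖ := by linarith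
  have h5 := norm_pos_iff.2 (torusMomentum_ne_zero hτ₀ hx)
  have h6 : τ.im ≤ 3 / 2 * τ₀.im := by
    have := (abs_lt.1 (abs_im_sub_lt_of_mem_ball hτ)).2
    linarith
  calc greenMode τ x ≤ (3 / 2 * τ₀.im) / (π * (‖torusMomentum τ₀ x‖ / 2) ^ 2) := by
        unfold greenMode; gcongr
    _ = 6 * greenMode τ₀ x := by unfold greenMode; field_simp; norm_num

lemma tetSummand_le_of_mem_ball {k : TetEdge → ℤ} (hk : ∀ e, 0 ≤ k e)
    (P : (ℤ × ℤ) × (ℤ × ℤ) × (ℤ × ℤ)) :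
    tetSummand k τ P ≤ monomial (fun _ => 6) k * tetSummand k τ₀ P := by
  by_cases hP : ∀ e, momentum P e ≠ 0
  · have hτ' := im_pos_of_mem_ball hτ₀ hτ
    rw [tetSummand_of_ne hP, tetSummand_of_ne hP, monomial, monomial, monomial,
      ← Finset.prod_mul_distrib]
    refine Finset.prod_le_prod (fun e _ => (zpow_pos (modes_pos hτ' hP e) _).le) fun e _ => ?_
    rw [← mul_zpow]
    exact zpow_le_zpow_left₀ (hk e) (modes_nonneg hτ' P e) (greenMode_le_of_mem_ball hτ₀ hτ (hP e))
  · simp [tetSummand_of_eq hP]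

lemma norm_tetGrad_le {k : TetEdge → ℤ} (hk : ∀ e, 0 ≤ k e)
    (P : (ℤ × ℤ) × (ℤ × ℤ) × (ℤ × ℤ)) :
    ‖tetGrad k τ P‖ ≤ monomial (fun _ => 6) k * tetSummand k τ₀ P *
      ((∑ e, (k e : ℝ)) * (τ₀.im / 2)⁻¹) := by
  have hτ' := im_pos_of_mem_ball hτ₀ hτ
  have h0 := tetSummand_nonneg hτ' k P
  have h1 := tetSummand_le_of_mem_ball hτ₀ hτ hk P
  have h2 := norm_phaseSum_le hk 1 τ P
  have h3 := half_im_lt_of_mem_ball hτ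
  rw [tetGrad, norm_mul, norm_mul, norm_inv, norm_mul, Complex.norm_I, one_mul,
    Complex.norm_of_nonneg h0, Complex.norm_of_nonneg hτ'.le]
  have h4 := h0.trans h1
  have h5 := (norm_nonneg _).trans h2
  gcongr

lemma norm_tetHess_le {k : TetEdge → ℤ} (hk : ∀ e, 0 ≤ k e)
    (P : (ℤ × ℤ) × (ℤ × ℤ) × (ℤ × ℤ)) :
    ‖tetHess k τ P‖ ≤ monomial (fun _ => 6) k * tetSummand k τ₀ P *
      (((∑ e, (k e : ℝ)) ^ 2 + 2 * ∑ e, (k e : ℝ)) / (τ₀.im / 2) ^ 2) := by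
  have hτ' := im_pos_of_mem_ball hτ₀ hτ
  have h0 := tetSummand_nonneg hτ' k P
  have h1 := tetSummand_le_of_mem_ball hτ₀ hτ hk P
  have hZ := norm_phaseSum_le hk 1 τ P
  have hZ2 := norm_phaseSum_le hk 2 τ P
  have h3 := half_im_lt_of_mem_ball hτ
  have hK : ‖∑ e, (k e : ℂ)‖ ≤ ∑ e, (k e : ℝ) := by
    refine norm_sum_le_of_le _ fun e _ => ?_
    rw [Complex.norm_intCast, abs_of_nonneg (by exact_mod_cast hk e)]
  have ha : ‖-phaseSum k 1 τ P ^ 2 / 2 + phaseSum k 1 τ P - phaseSum k 2 τ P / 2‖ ≤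
      (∑ e, (k e : ℝ)) ^ 2 / 2 + (∑ e, (k e : ℝ)) + (∑ e, (k e : ℝ)) / 2 := by
    refine (norm_sub_le _ _).trans (add_le_add ((norm_add_le _ _).trans (add_le_add ?_ hZ)) ?_)
    · rw [norm_div, norm_neg, norm_pow, RCLike.norm_ofNat]
      gcongr
    · rw [norm_div, RCLike.norm_ofNat]
      gcongr
  have hb : ‖phaseSum k 1 τ P * conj (phaseSum k 1 τ P) - ∑ e, (k e : ℂ)‖ ≤
      (∑ e, (k e : ℝ)) ^ 2 + ∑ e, (k e : ℝ) := by
    refine (norm_sub_le _ _).trans (add_le_add ?_ hK)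
    rw [norm_mul, RCLike.norm_conj, ← sq]
    gcongr
  refine (norm_wirtinger_le _ _).trans ?_
  rw [norm_div, norm_div, norm_mul, norm_mul, norm_mul, norm_pow, RCLike.norm_ofNat,
    Complex.norm_of_nonneg h0, Complex.norm_of_nonneg hτ'.le]
  generalize (∑ e, (k e : ℝ)) = K at *
  calc _ ≤ tetSummand k τ P * (K ^ 2 / 2 + K + K / 2) / τ.im ^ 2 +
        tetSummand k τ P * (K ^ 2 + K) / (2 * τ.im ^ 2) := by gcongr
    _ = tetSummand k τ P * ((K ^ 2 + 2 * K) / τ.im ^ 2) := by field_simp; ring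
    _ ≤ _ := by
      have hK0 : 0 ≤ K := (norm_nonneg _).trans hK
      gcongr
      exact mul_nonneg (monomial_pos (fun _ => by norm_num) k).le (tetSummand_nonneg hτ₀ k P)

end Comparison

lemma continuousOn_phase (x : ℤ × ℤ) (hx : x ≠ 0) :
    ContinuousOn (fun τ => phase τ x) {τ : ℂ | 0 < τ.im} := fun _ hτ =>
  (hasWirtinger_phase hτ hx).continuousAt.continuousWithinAt

lemma ContinuousOn.wirtinger {α β : ℂ → ℂ} {S : Set ℂ} (hα : ContinuousOn α S)
    (hβ : ContinuousOn β S) : ContinuousOn (fun τ => _root_.wirtinger (α τ) (β τ)) S :=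
  continuous_wirtinger.comp_continuousOn (hα.prodMk hβ)

lemma continuousOn_tetHess (k : TetEdge → ℤ) (P : (ℤ × ℤ) × (ℤ × ℤ) × (ℤ × ℤ)) :
    ContinuousOn (fun τ => tetHess k τ P) {τ : ℂ | 0 < τ.im} := by
  by_cases hP : ∀ e, momentum P e ≠ 0
  · have h1 : ∀ n, ContinuousOn (fun τ => phaseSum k n τ P) {τ : ℂ | 0 < τ.im} := fun n =>
      continuousOn_finsetSum _ fun e _ =>
        continuousOn_const.mul ((continuousOn_phase _ (hP e)).pow n)
    have h2 : ContinuousOn (fun τ => (tetSummand k τ P : ℂ)) {τ : ℂ | 0 < τ.im} := fun τ hτ =>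
      (hasWirtinger_tetSummand k hτ P).continuousAt.continuousWithinAt
    have h3 : ContinuousOn (fun τ : ℂ => (τ.im : ℂ)) {τ : ℂ | 0 < τ.im} :=
      (Complex.continuous_ofReal.comp Complex.continuous_im).continuousOn
    have h4 : ∀ τ ∈ {τ : ℂ | 0 < τ.im}, (τ.im : ℂ) ^ 2 ≠ 0 := fun τ hτ =>
      pow_ne_zero 2 (by exact_mod_cast (ne_of_gt hτ))
    simp only [tetHess]
    refine ContinuousOn.wirtinger ?_ ?_
    · exact (h2.mul (((((h1 1).pow 2).neg.div_const 2).add (h1 1)).sub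
        ((h1 2).div_const 2))).div (h3.pow 2) h4
    · exact (h2.mul (((h1 1).mul (Complex.continuous_conj.comp_continuousOn (h1 1))).sub
        continuousOn_const)).div (continuousOn_const.mul (h3.pow 2))
        fun τ hτ => mul_ne_zero two_ne_zero (h4 τ hτ)
  · simp only [tetHess, tetSummand_of_eq hP]
    simp only [Complex.ofReal_zero, zero_mul, zero_div]
    exact continuousOn_const

/-! ### Termwise differentiation of the series. -/

section Series

variable {k : TetEdge → ℤ} (hk : ∀ e, 0 ≤ k e) {τ₀ : ℂ} (hτ₀ : 0 < τ₀.im)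
  (hs : Summable (tetSummand k τ₀)) {τ : ℂ} (hτ : τ ∈ Metric.ball τ₀ (τ₀.im / 2))
include hk hτ₀ hs

lemma summable_tetGrad (hτ : τ ∈ Metric.ball τ₀ (τ₀.im / 2)) : Summable (tetGrad k τ) :=
  Summable.of_norm_bounded ((hs.mul_left _).mul_right _) (norm_tetGrad_le hτ₀ hτ hk)

lemma summable_tetHess (hτ : τ ∈ Metric.ball τ₀ (τ₀.im / 2)) : Summable (tetHess k τ) :=
  Summable.of_norm_bounded ((hs.mul_left _).mul_right _) (norm_tetHess_le hτ₀ hτ hk)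

lemma hasFDerivAt_tetC (hτ : τ ∈ Metric.ball τ₀ (τ₀.im / 2)) :
    HasFDerivAt (tetC k) (rePairing (∑' P, tetGrad k τ P)) τ := by
  rw [rePairing.map_tsum (summable_tetGrad hk hτ₀ hs hτ)]
  refine hasFDerivAt_tsum_of_isPreconnected (f := fun P τ => tetSummand k τ P)
    (f' := fun P τ => rePairing (tetGrad k τ P))
    (((hs.mul_left (monomial (fun _ => 6) k)).mul_right
      ((∑ e, (k e : ℝ)) * (τ₀.im / 2)⁻¹)).mul_left ‖rePairing‖) Metric.isOpen_ball
    (convex_ball τ₀ (τ₀.im / 2)).isPreconnected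
    (fun P _ hτ => hasFDerivAt_tetSummand k (im_pos_of_mem_ball hτ₀ hτ) P)
    (fun P τ hτ => ?_) (Metric.mem_ball_self (half_pos hτ₀)) hs hτ
  exact (rePairing.le_opNorm _).trans
    (mul_le_mul_of_nonneg_left (norm_tetGrad_le hτ₀ hτ hk P) (norm_nonneg _))

lemma hasFDerivAt_tsum_tetGrad (hτ : τ ∈ Metric.ball τ₀ (τ₀.im / 2)) :
    HasFDerivAt (fun τ => ∑' P, tetGrad k τ P) (∑' P, tetHess k τ P) τ :=
  hasFDerivAt_tsum_of_isPreconnected (f := fun P τ => tetGrad k τ P)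
    (f' := fun P τ => tetHess k τ P)
    ((hs.mul_left _).mul_right _) Metric.isOpen_ball
    (convex_ball τ₀ (τ₀.im / 2)).isPreconnected
    (fun P _ hτ => hasFDerivAt_tetGrad k (im_pos_of_mem_ball hτ₀ hτ) P)
    (fun P _ hτ => norm_tetHess_le hτ₀ hτ hk P) (Metric.mem_ball_self (half_pos hτ₀))
    (summable_tetGrad hk hτ₀ hs (Metric.mem_ball_self (half_pos hτ₀))) hτ

lemma continuousOn_tsum_tetHess :
    ContinuousOn (fun τ => ∑' P, tetHess k τ P) (Metric.ball τ₀ (τ₀.im / 2)) :=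
  continuousOn_tsum
    (fun P => (continuousOn_tetHess k P).mono fun _ hτ => im_pos_of_mem_ball hτ₀ hτ)
    ((hs.mul_left _).mul_right _) fun P _ hτ => norm_tetHess_le hτ₀ hτ hk P

lemma contDiffAt_tetC : ContDiffAt ℝ 2 (tetC k) τ₀ := by
  have hmem : Metric.ball τ₀ (τ₀.im / 2) ∈ nhds τ₀ := Metric.ball_mem_nhds _ (half_pos hτ₀)
  have h1 : ContDiffAt ℝ ((0 : ℕ) + 1) (fun τ => ∑' P, tetGrad k τ P) τ₀ :=
    contDiffAt_succ_iff_hasFDerivAt.2 ⟨fun τ => ∑' P, tetHess k τ P,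
      ⟨_, hmem, fun _ hτ => hasFDerivAt_tsum_tetGrad hk hτ₀ hs hτ⟩,
      contDiffAt_zero.2 ⟨_, hmem, continuousOn_tsum_tetHess hk hτ₀ hs⟩⟩
  have h2 : ContDiffAt ℝ ((1 : ℕ) + 1) (tetC k) τ₀ :=
    contDiffAt_succ_iff_hasFDerivAt.2 ⟨fun τ => rePairing (∑' P, tetGrad k τ P),
      ⟨_, hmem, fun _ hτ => hasFDerivAt_tetC hk hτ₀ hs hτ⟩,
      rePairing.contDiff.contDiffAt.comp τ₀ (by simpa using h1)⟩
  simpa [one_add_one_eq_two] using h2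

lemma hasSum_modularLaplacian_tetC :
    HasSum (fun P => tetSummand k τ₀ P *
      (Complex.normSq (phaseSum k 1 τ₀ P) - ∑ e, (k e : ℝ))) (modularLaplacian (tetC k) τ₀) := by
  have hmem : Metric.ball τ₀ (τ₀.im / 2) ∈ nhds τ₀ := Metric.ball_mem_nhds _ (half_pos hτ₀)
  have hself := Metric.mem_ball_self (x := τ₀) (half_pos hτ₀)
  have h1 : fderiv ℝ (tetC k) =ᶠ[nhds τ₀] fun τ => rePairing (∑' P, tetGrad k τ P) := by
    filter_upwards [hmem] with τ hτ using (hasFDerivAt_tetC hk hτ₀ hs hτ).fderiv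
  have h2 := rePairing.hasFDerivAt.comp τ₀ (hasFDerivAt_tsum_tetGrad hk hτ₀ hs hself)
  have h3 : fderiv ℝ (fderiv ℝ (tetC k)) τ₀ = rePairing.comp (∑' P, tetHess k τ₀ P) :=
    h1.fderiv_eq.trans h2.fderiv
  have h4 := (summable_tetHess hk hτ₀ hs hself).hasSum
  have h5 : ∀ v : ℂ, HasSum (fun P => rePairing (tetHess k τ₀ P v) v)
      (rePairing ((∑' P, tetHess k τ₀ P) v) v) := fun v =>
    (((rePairing.flip v).comp (ContinuousLinearMap.apply ℝ ℂ v)).hasSum h4 :)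
  have h6 := ((h5 1).add (h5 Complex.I)).mul_left (τ₀.im ^ 2)
  have ht : (τ₀.im : ℂ) ≠ 0 := by exact_mod_cast hτ₀.ne'
  have ht' := hτ₀.ne'
  have h8 : ∀ P, tetSummand k τ₀ P *
      (Complex.normSq (phaseSum k 1 τ₀ P) - ∑ e, (k e : ℝ)) = τ₀.im ^ 2 *
        (rePairing (tetHess k τ₀ P 1) 1 + rePairing (tetHess k τ₀ P Complex.I) Complex.I) := by
    intro P
    -- For `D h = α h + β h̄` one has `D 1 · 1 + D i · i = 2 β`: the trace retains only the
    -- antiholomorphic part, which is already real.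
    have h7 : tetHess k τ₀ P 1 * 1 + tetHess k τ₀ P Complex.I * Complex.I =
        ((tetSummand k τ₀ P * (Complex.normSq (phaseSum k 1 τ₀ P) - ∑ e, (k e : ℝ)) /
          τ₀.im ^ 2 : ℝ) : ℂ) := by
      push_cast
      rw [← Complex.mul_conj, tetHess, wirtinger_apply, wirtinger_apply, map_one, Complex.conj_I]
      field_simp
      ring_nf
      simp only [Complex.I_sq]
      ring
    rw [rePairing_apply, rePairing_apply, ← Complex.add_re, h7, Complex.ofReal_re]
    field_simp
  have h9 : modularLaplacian (tetC k) τ₀ = τ₀.im ^ 2 *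
      (rePairing ((∑' P, tetHess k τ₀ P) 1) 1 +
        rePairing ((∑' P, tetHess k τ₀ P) Complex.I) Complex.I) := by
    rw [modularLaplacian, InnerProductSpace.laplacian_eq_iteratedFDeriv_complexPlane]
    simp [iteratedFDeriv_two_apply, h3]
  rw [h9, funext h8]
  exact h6

end Series

/-! ### The algebraic identity for a single summand. -/

/-- With `z = p q̄` the product of phases is `z̄² / |z|²`, and `Re z² = 2 (Re z)² - |z|²`. -/
lemma two_mul_re_phase_mul_conj {τ : ℂ} (hτ : 0 < τ.im) {x y : ℤ × ℤ} (hx : x ≠ 0) (hy : y ≠ 0) :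
    2 * (phase τ x * conj (phase τ y)).re =
      (2 * (torusMomentum τ x * conj (torusMomentum τ y)).re) ^ 2 /
        (Complex.normSq (torusMomentum τ x) * Complex.normSq (torusMomentum τ y)) - 2 := by
  have hp := torusMomentum_ne_zero hτ hx
  have hq := torusMomentum_ne_zero hτ hy
  rw [phase, phase]
  generalize torusMomentum τ x = p at *
  generalize torusMomentum τ y = q at *
  have hp' : conj p ≠ 0 := (map_ne_zero _).2 hp
  have hq' : conj q ≠ 0 := (map_ne_zero _).2 hq
  have hP := (Complex.normSq_pos.2 hp).ne'
  have hQ := (Complex.normSq_pos.2 hq).ne'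
  have h1 : conj p / p * conj (conj q / q) =
      ((Complex.normSq p * Complex.normSq q)⁻¹ : ℝ) * (conj (p * conj q)) ^ 2 := by
    push_cast
    rw [← Complex.mul_conj, ← Complex.mul_conj]
    simp only [map_div₀, map_mul, Complex.conj_conj]
    field_simp
  have h2 : Complex.normSq p * Complex.normSq q =
      (p * conj q).re ^ 2 + (p * conj q).im ^ 2 := by
    rw [← Complex.normSq_conj q, ← Complex.normSq_mul, Complex.normSq_apply]
    ring
  rw [h1, Complex.re_ofReal_mul, sq (conj _), Complex.mul_re, Complex.conj_re, Complex.conj_im]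
  have h3 : (p * conj q).im ^ 2 = Complex.normSq p * Complex.normSq q - (p * conj q).re ^ 2 := by
    linarith
  rw [show (p * conj q).re * (p * conj q).re - -(p * conj q).im * -(p * conj q).im =
    (p * conj q).re ^ 2 - (p * conj q).im ^ 2 by ring, h3]
  field_simp
  ring

lemma normSq_phase {τ : ℂ} (hτ : 0 < τ.im) {x : ℤ × ℤ} (hx : x ≠ 0) :
    Complex.normSq (phase τ x) = 1 := by
  rw [phase, map_div₀, Complex.normSq_conj,
    div_self (Complex.normSq_pos.2 (torusMomentum_ne_zero hτ hx)).ne']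

namespace TetEdge

/-- Polarization: `|v|² + |v + x + y|² - |v + x|² - |v + y|² = 2 Re x ȳ`, where the four vectors on
the left are, up to sign, the momenta of the 4-cycle complementary to `a, b`. The sign `ε` reflects
orientations and is later squared away. -/
lemma two_mul_re_opposite {a b c c' d d' : TetEdge} (h : (a, b, c, c', d, d') ∈ oppositePairs)
    (τ : ℂ) (P : (ℤ × ℤ) × (ℤ × ℤ) × (ℤ × ℤ)) : ∃ ε : ℝ, ε ^ 2 = 1 ∧
      2 * (torusMomentum τ (momentum P a) * conj (torusMomentum τ (momentum P b))).re =
        ε * (Complex.normSq (torusMomentum τ (momentum P c)) +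
          Complex.normSq (torusMomentum τ (momentum P c')) -
          Complex.normSq (torusMomentum τ (momentum P d)) -
          Complex.normSq (torusMomentum τ (momentum P d'))) := by
  simp only [oppositePairs, List.mem_cons, Prod.mk.injEq, List.not_mem_nil, or_false] at h
  rcases h with ⟨rfl, rfl, rfl, rfl, rfl, rfl⟩ | ⟨rfl, rfl, rfl, rfl, rfl, rfl⟩ |
    ⟨rfl, rfl, rfl, rfl, rfl, rfl⟩ <;>
  simp only [momentum, torusMomentum_add, Complex.normSq_apply, Complex.mul_re, Complex.conj_re,
    Complex.conj_im, Complex.add_re, Complex.add_im] <;> first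
    | exact ⟨1, by norm_num, by ring1⟩
    | exact ⟨-1, by norm_num, by ring1⟩

end TetEdge

section Identity

variable {k : TetEdge → ℤ} {τ : ℂ} (hτ : 0 < τ.im) {P : (ℤ × ℤ) × (ℤ × ℤ) × (ℤ × ℤ)}
  (hP : ∀ e, momentum P e ≠ 0)
include hτ hP

lemma normSq_momentum_pos (e : TetEdge) :
    0 < Complex.normSq (torusMomentum τ (momentum P e)) :=
  Complex.normSq_pos.2 (torusMomentum_ne_zero hτ (hP e))

lemma sum_adjacentTerms {A : TetEdge × TetEdge × TetEdge} (hA : A ∈ adjacentPairs) :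
    ((adjacentTerms A).map fun x => (x.1 : ℝ) * tetSummand (k + x.2) τ P).sum =
      tetSummand k τ P *
        (2 * (phase τ (momentum P A.1) * conj (phase τ (momentum P A.2.1))).re) := by
  obtain ⟨a, b, c⟩ := A
  obtain ⟨ε, hε, hc⟩ := (show Star a b c from Or.inl hA).normSq_eq τ P
  have hu := modes_pos hτ hP
  simp only [adjacentTerms, List.map_cons, List.map_nil, List.sum_cons, List.sum_nil,
    tetSummand_of_ne hP, monomial_add hu, monomial_sub hu, monomial_nsmul, monomial_neg,
    monomial_unit, two_mul_re_phase_mul_conj hτ (hP _) (hP _), modes_eq_div_normSq]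
  have ht : 0 < τ.im / π := by positivity
  have hXa := normSq_momentum_pos hτ hP a
  have hXb := normSq_momentum_pos hτ hP b
  have hXc := normSq_momentum_pos hτ hP c
  generalize monomial (modes τ P) k = F
  generalize (torusMomentum τ (momentum P a) * conj (torusMomentum τ (momentum P b))).re = R at *
  have hR : (2 * R) ^ 2 = (Complex.normSq (torusMomentum τ (momentum P c)) -
      Complex.normSq (torusMomentum τ (momentum P a)) -
      Complex.normSq (torusMomentum τ (momentum P b))) ^ 2 := by
    rw [hc]
    linear_combination (-4 * R ^ 2) * hε
  rw [hR]
  clear hR hc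
  generalize τ.im / π = t at *
  generalize Complex.normSq (torusMomentum τ (momentum P a)) = X at *
  generalize Complex.normSq (torusMomentum τ (momentum P b)) = Y at *
  generalize Complex.normSq (torusMomentum τ (momentum P c)) = Z at *
  push_cast
  field_simp
  ring

/-- The ten terms are the expansion of `(|p_c|² + |p_c'|² - |p_d|² - |p_d'|²)² / (|p_a|² |p_b|²)`.
No constant arises to absorb the `-2` of `two_mul_re_phase_mul_conj`, hence the `+ 2`. -/
lemma sum_oppositeTerms {B : TetEdge × TetEdge × TetEdge × TetEdge × TetEdge × TetEdge}
    (hB : B ∈ oppositePairs) :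
    ((oppositeTerms B).map fun x => (x.1 : ℝ) * tetSummand (k + x.2) τ P).sum =
      tetSummand k τ P *
        (2 * (phase τ (momentum P B.1) * conj (phase τ (momentum P B.2.1))).re + 2) := by
  obtain ⟨a, b, c, c', d, d'⟩ := B
  obtain ⟨ε, hε, hR⟩ := two_mul_re_opposite hB τ P
  have hu := modes_pos hτ hP
  simp only [oppositeTerms, List.map_cons, List.map_nil, List.sum_cons, List.sum_nil,
    tetSummand_of_ne hP, monomial_add hu, monomial_sub hu, monomial_nsmul,
    monomial_unit, two_mul_re_phase_mul_conj hτ (hP _) (hP _), modes_eq_div_normSq]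
  have ht : 0 < τ.im / π := by positivity
  have hX := normSq_momentum_pos hτ hP
  have hXa := hX a
  have hXb := hX b
  have hXc := hX c
  have hXc' := hX c'
  have hXd := hX d
  have hXd' := hX d'
  rw [hR, mul_pow, hε]
  clear hR hX hB
  generalize monomial (modes τ P) k = F
  generalize τ.im / π = t at *
  generalize Complex.normSq (torusMomentum τ (momentum P a)) = X at *
  generalize Complex.normSq (torusMomentum τ (momentum P b)) = Y at *
  generalize Complex.normSq (torusMomentum τ (momentum P c)) = Z at *
  generalize Complex.normSq (torusMomentum τ (momentum P c')) = Z' at *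
  generalize Complex.normSq (torusMomentum τ (momentum P d)) = W at *
  generalize Complex.normSq (torusMomentum τ (momentum P d')) = W' at *
  push_cast
  field_simp
  ring

lemma normSq_phaseSum :
    Complex.normSq (phaseSum k 1 τ P) = ∑ e, (k e : ℝ) ^ 2 +
      (adjacentPairs.map fun A => (k A.1 : ℝ) * (k A.2.1 : ℝ) *
        (2 * (phase τ (momentum P A.1) * conj (phase τ (momentum P A.2.1))).re)).sum +
      (oppositePairs.map fun B => (k B.1 : ℝ) * (k B.2.1 : ℝ) *
        (2 * (phase τ (momentum P B.1) * conj (phase τ (momentum P B.2.1))).re)).sum := by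
  have h : ∀ e, (phase τ (momentum P e)).re * (phase τ (momentum P e)).re +
      (phase τ (momentum P e)).im * (phase τ (momentum P e)).im = 1 := fun e => by
    rw [← Complex.normSq_apply, normSq_phase hτ (hP e)]
  generalize hz : (fun e => phase τ (momentum P e)) = z
  have hz' : ∀ e, phase τ (momentum P e) = z e := congrFun hz
  simp only [hz', phaseSum] at h ⊢
  simp only [sum_univ, adjacentPairs, oppositePairs, List.map_cons, List.map_nil, List.sum_cons,
    List.sum_nil, pow_one, Complex.normSq_apply, Complex.add_re, Complex.add_im, Complex.mul_re,
    Complex.mul_im, Complex.conj_re, Complex.conj_im, Complex.intCast_re, Complex.intCast_im]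
  linear_combination (k .s : ℝ) ^ 2 * h .s + (k .t : ℝ) ^ 2 * h .t + (k .p : ℝ) ^ 2 * h .p +
    (k .q : ℝ) ^ 2 * h .q + (k .w : ℝ) ^ 2 * h .w + (k .r : ℝ) ^ 2 * h .r

end Identity

/-- The diagonal terms `k_e² - k_e` and the `-2` left over for each opposite pair add up to exactly
`ω`. -/
lemma tetSummand_identity (k : TetEdge → ℤ) {τ : ℂ} (hτ : 0 < τ.im)
    (P : (ℤ × ℤ) × (ℤ × ℤ) × (ℤ × ℤ)) :
    tetSummand k τ P * (Complex.normSq (phaseSum k 1 τ P) - ∑ e, (k e : ℝ)) -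
        (tetOmega k : ℝ) * tetSummand k τ P =
      (adjacentPairs.map fun A => (k A.1 : ℝ) * (k A.2.1 : ℝ) *
        ((adjacentTerms A).map fun x => (x.1 : ℝ) * tetSummand (k + x.2) τ P).sum).sum +
      (oppositePairs.map fun B => (k B.1 : ℝ) * (k B.2.1 : ℝ) *
        ((oppositeTerms B).map fun x => (x.1 : ℝ) * tetSummand (k + x.2) τ P).sum).sum := by
  by_cases hP : ∀ e, momentum P e ≠ 0
  · rw [List.map_congr_left (l := adjacentPairs) (g := fun A => (k A.1 : ℝ) *
          (k A.2.1 : ℝ) * (tetSummand k τ P *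
            (2 * (phase τ (momentum P A.1) * conj (phase τ (momentum P A.2.1))).re)))
        fun A hA => by rw [sum_adjacentTerms hτ hP hA],
      List.map_congr_left (l := oppositePairs) (g := fun B => (k B.1 : ℝ) *
          (k B.2.1 : ℝ) * (tetSummand k τ P *
            (2 * (phase τ (momentum P B.1) * conj (phase τ (momentum P B.2.1))).re + 2)))
        fun B hB => by rw [sum_oppositeTerms hτ hP hB],
      normSq_phaseSum hτ hP, tetOmega]
    generalize tetSummand k τ P = F
    simp only [sum_univ, adjacentPairs, oppositePairs, List.map_cons, List.map_nil, List.sum_cons,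
      List.sum_nil]
    push_cast
    ring
  · simp [tetSummand_of_eq hP]

lemma hasSum_list_sum {ι κ : Type*} {f : ι → κ → ℝ} {a : ι → ℝ} (L : List ι)
    (h : ∀ i ∈ L, HasSum (f i) (a i)) :
    HasSum (fun P => (L.map fun i => f i P).sum) (L.map a).sum := by
  induction L with
  | nil => simp
  | cons i L ih =>
    simp only [List.map_cons, List.sum_cons]
    exact (h i List.mem_cons_self).add (ih fun j hj => h j (List.mem_cons_of_mem i hj))

lemma hasSum_tetCombination {k : TetEdge → ℤ} {τ : ℂ} {L : List (ℤ × (TetEdge → ℤ))}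
    (h : ∀ x ∈ L, Summable (tetSummand (k + x.2) τ)) :
    HasSum (fun P => (L.map fun x => (x.1 : ℝ) * tetSummand (k + x.2) τ P).sum)
      (tetCombination k τ L) :=
  hasSum_list_sum L fun x hx => (h x hx).hasSum.mul_left _

theorem mainTheorem1 (k : TetEdge → ℤ) (hk : ∀ e, 1 ≤ k e) :
    ContDiffOn ℝ 2 (tetC k) {τ : ℂ | 0 < τ.im} ∧
    ∀ τ : ℂ, 0 < τ.im →
      Summable (tetSummand k τ) ∧
      (∀ A ∈ TetEdge.adjacentPairs, ∀ x ∈ TetEdge.adjacentTerms A,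
        Summable (tetSummand (k + x.2) τ)) ∧
      (∀ B ∈ TetEdge.oppositePairs, ∀ x ∈ TetEdge.oppositeTerms B,
        Summable (tetSummand (k + x.2) τ)) ∧
      modularLaplacian (tetC k) τ - (tetOmega k : ℝ) * tetC k τ =
        (TetEdge.adjacentPairs.map fun A =>
          (k A.1 : ℝ) * (k A.2.1 : ℝ) *
            tetCombination k τ (TetEdge.adjacentTerms A)).sum +
        (TetEdge.oppositePairs.map fun B =>
          (k B.1 : ℝ) * (k B.2.1 : ℝ) *
            tetCombination k τ (TetEdge.oppositeTerms B)).sum := by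
  have hk0 : ∀ e, 0 ≤ k e := fun e => zero_le_one.trans (hk e)
  have hs : ∀ τ : ℂ, 0 < τ.im → Summable (tetSummand k τ) := fun τ hτ =>
    summable_tetSummand_mono hτ hk (summable_tetSummand_one hτ)
  refine ⟨fun τ hτ => (contDiffAt_tetC hk0 hτ (hs τ hτ)).contDiffWithinAt, fun τ hτ => ?_⟩
  have hA : ∀ A ∈ adjacentPairs, ∀ x ∈ adjacentTerms A, Summable (tetSummand (k + x.2) τ) :=
    -- Positivity of the exponents enters here: `1 + δ ≤ k + δ`.
    fun A hA x hx => summable_tetSummand_mono hτ (add_le_add_left hk x.2)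
      (summable_adjacentTerms hA hx hτ)
  have hB : ∀ B ∈ oppositePairs, ∀ x ∈ oppositeTerms B, Summable (tetSummand (k + x.2) τ) :=
    fun B hB x hx => summable_tetSummand_mono hτ (add_le_add_left hk x.2)
      (summable_oppositeTerms hB hx hτ)
  refine ⟨hs τ hτ, hA, hB, ?_⟩
  have h1 := (hasSum_modularLaplacian_tetC hk0 hτ (hs τ hτ)).sub
    ((hs τ hτ).hasSum.mul_left (tetOmega k : ℝ))
  have h2 := (hasSum_list_sum adjacentPairs fun A h =>
    (hasSum_tetCombination (hA A h)).mul_left ((k A.1 : ℝ) * (k A.2.1 : ℝ))).add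
    (hasSum_list_sum oppositePairs fun B h =>
      (hasSum_tetCombination (hB B h)).mul_left ((k B.1 : ℝ) * (k B.2.1 : ℝ)))
  simp only [tetSummand_identity k hτ] at h1
  exact h1.unique h2
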